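/- Let $N, M \in \mathbb{N}$. For $k = 1, 2, \ldots$ let $\mu^{(k)} \in \Delta_N$ and $\nu^{(k)} \in \Delta_M$ be probability vectors, let $\Pi(\mu^{(k)}, \nu^{(k)})$ be the set of matrices in $\mathbb{R}_{+}^{N \times M}$ with row sums $\mu^{(k)}$ and column sums $\nu^{(k)}$, and let $\pi^{(k)} \in \Pi(\mu^{(k)}, \nu^{(k)})$ and $\alpha^{(k)} \in \mathbb{R}$. Assume that $c \in \mathbb{R}^{N \times M}$ is a cost matrix for which every $\pi^{(k)}$ is an optimal transport plan with total cost $\alpha^{(k)}$, i.e. $$\alpha^{(k)} = \min_{\pi \in \Pi(\mu^{(k)}, \nu^{(k)})} \langle c, \pi \rangle = \langle c, \pi^{(k)} \rangle, \qquad k = 1, 2, \ldots,$$ where $\langle \cdot, \cdot \rangle$ is the Frobenius inner product. We observe the plans $\pi^{(k)}$ and $$y^{(k)} = \alpha^{(k)} + \varepsilon^{(k)}, \qquad k = 1, 2, \ldots,$$ where $\varepsilon^{(1)}, \varepsilon^{(2)}, \ldots$ are independent centered real random variables with common variance $\sigma^2 > 0$. For a matrix $b \in \mathbb{R}^{N \times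 M}$ write $\boldsymbol{b} \in \mathbb{R}^{NM}$ for its column-major vectorization. Let $P_K \in \mathbb{R}^{K \times NM}$ be the matrix with rows $(\boldsymbol{\pi}^{(1)})^{\top}, \ldots, (\boldsymbol{\pi}^{(K)})^{\top}$, put $\boldsymbol{Y}_K = (y^{(1)}, \ldots, y^{(K)})^{\top}$, and let $\hat{c}_K$ be a least squares estimator, i.e. a random matrix with $$\hat{c}_K \in \operatorname*{arg\,min}_{b \in \mathbb{R}^{N \times M}} \| \boldsymbol{Y}_K - P_K \boldsymbol{b} \|_2^2 \quad \text{almost surely.}$$ Suppose that there is a positive definite matrix $Q \in \mathbb{R}^{NM \times NM}$ such that $$\frac{1}{K} P_K^{\top} P_K \to Q \qquad \text{as } K \to \infty.$$ Then $\hat{c}_K$ is strongly consistent: $\hat{\boldsymbol{c}}_K \to \boldsymbol{c}$ almost surely as $K \to \infty$. If, in addition, there is a $\delta > 0$ such that the $(2+\delta)$-th absolute moments of the $\varepsilon^{(k)}$ exist and are bounded uniformly in $k$, then $$\sqrt{K} \, (\hat{\boldsymbol{c}}_K - \boldsymbol{c}) \to \mathcal{N}(\boldsymbol{0}, \sigma^2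 Q^{-1}) \qquad \text{in distribution as } K \to \infty,$$ where $\mathcal{N}(\boldsymbol{0}, \Sigma)$ is the $NM$-dimensional normal distribution with mean $\boldsymbol{0}$ and covariance matrix $\Sigma$. -/

import Mathlib

open MeasureTheory ProbabilityTheory Filter Topology

noncomputable section

namespace InverseOT

/-- The set `Π(μ, ν)` of transport plans: nonnegative `N × M` matrices with row sums `μ` and
column sums `ν`. -/
def transportPlans {N M : ℕ} (μ : Fin N → ℝ) (ν : Fin M → ℝ) :
    Set (Matrix (Fin N) (Fin M) ℝ) :=
  {π | (∀ i j, 0 ≤ π i j) ∧ (∀ i, ∑ j, π i j = μ i) ∧ (∀ j, ∑ i, π i j = ν j)}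

/-- The Frobenius inner product of two matrices. -/
def frobInner {N M : ℕ} (a b : Matrix (Fin N) (Fin M) ℝ) : ℝ :=
  ∑ i, ∑ j, a i j * b i j

/-- The optimal transport cost `OT_c(μ, ν)`. For probability vectors `μ`, `ν` the infimum is taken
over a nonempty compact set, so it is a minimum. -/
def otCost {N M : ℕ} (c : Matrix (Fin N) (Fin M) ℝ) (μ : Fin N → ℝ) (ν : Fin M → ℝ) : ℝ :=
  sInf (frobInner c '' transportPlans μ ν)

/-- Vectorization of an `N × M` matrix as an element of Euclidean space of dimension `N * M`.
`Matrix.vec` stacks the columns; the entry `(i, j)` of the matrix sits at the index `(j, i)`. -/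
def vecE {N M : ℕ} (c : Matrix (Fin N) (Fin M) ℝ) : EuclideanSpace ℝ (Fin M × Fin N) :=
  WithLp.toLp 2 c.vec

/-- The design matrix `P_K`, whose rows are the vectorizations of the first `K` plans. -/
def designMatrix {N M : ℕ} (π : ℕ → Matrix (Fin N) (Fin M) ℝ) (K : ℕ) :
    Matrix (Fin K) (Fin M × Fin N) ℝ :=
  Matrix.of fun k => (π k).vec

/-- The vector `Y_K` of the first `K` noisy observations `y k = α k + ε k`. -/
def observations {Ω : Type*} (α : ℕ → ℝ) (ε : ℕ → Ω → ℝ) (K : ℕ) (ω : Ω) :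
    EuclideanSpace ℝ (Fin K) :=
  WithLp.toLp 2 fun k => α k + ε k ω

/-- The set of least squares solutions `argmin_b ‖Y - P b‖₂²`, where `b` ranges over all
`N × M` matrices and `P` acts on the vectorization of `b`. -/
def leastSquares {N M K : ℕ} (P : Matrix (Fin K) (Fin M × Fin N) ℝ)
    (Y : EuclideanSpace ℝ (Fin K)) : Set (Matrix (Fin N) (Fin M) ℝ) :=
  {b | ∀ b' : Matrix (Fin N) (Fin M) ℝ,
    ‖Y - WithLp.toLp 2 (P.mulVec b.vec)‖ ^ 2 ≤ ‖Y - WithLp.toLp 2 (P.mulVec b'.vec)‖ ^ 2}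

end InverseOT

end

/-! Since `α k` is the cost of the plan `π k`, the model is a linear regression `Y = P_K c + ε` with
deterministic design. With `G_K = K⁻¹ P_Kᵀ P_K`, the normal equations become `G_K (ĉ_K - c) = K⁻¹ ∑
ε_k π_k`. Because `G_K → Q` and `Q` is invertible, `G_K⁻¹` eventually exists and tends to `Q⁻¹`, so
only the weighted noise sum has to be controlled.

Consistency: entries of plans lie in `[0, 1]`, so each coordinate of the right-hand side averages
independent centered variables of variance at most `σ²`. Such averages vanish almost surely by
Kolmogorov's strong law (`ae_tendsto_average_of_variance_le`), obtained from martingale convergence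
and Kronecker's lemma.

Normality: by Lévy's continuity theorem it suffices to treat `√K ⟨ĉ_K - c, t⟩ = ∑ u_k ε_k` with `u_k
= K^(-1/2) ⟨G_K⁻ᵀ t, π_k⟩`. These weights are uniformly `O(K^(-1/2))` and `∑ u_k² → tᵀ Q⁻¹ t`, so
Lyapunov's theorem for characteristic functions (`tendsto_prod_charFun`) yields the limit `exp(-σ²
tᵀ Q⁻¹ t / 2)`. -/

namespace InverseOT

/-! ### Kolmogorov's strong law of large numbers -/

/-- Kronecker's lemma for the weights `1, 2, 3, …`. -/
lemma tendsto_average_of_tendsto_sum_div {a : ℕ → ℝ} {l : ℝ}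
    (h : Tendsto (fun n => ∑ k ∈ Finset.range n, a k / (k + 1)) atTop (𝓝 l)) :
    Tendsto (fun n : ℕ => (n : ℝ)⁻¹ * ∑ k ∈ Finset.range n, a k) atTop (𝓝 0) := by
  -- Summation by parts: the average of `a` is the `n`-th partial sum of the series minus the Cesàro
  -- mean of the earlier ones, and both tend to `l`.
  have key : ∀ n : ℕ, ∑ k ∈ Finset.range n, a k =
      n * (∑ k ∈ Finset.range n, a k / (k + 1)) -
        ∑ j ∈ Finset.range n, ∑ k ∈ Finset.range j, a k / (k + 1) := by
    intro n
    induction n with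
    | zero => simp
    | succ n ih =>
      rw [Finset.sum_range_succ, ih, Finset.sum_range_succ _ n, Finset.sum_range_succ _ n]
      push_cast
      field_simp
      ring
  have hlim := h.sub h.cesaro
  rw [sub_self] at hlim
  refine hlim.congr' ?_
  filter_upwards [eventually_gt_atTop 0] with n hn
  have : (n : ℝ) ≠ 0 := by positivity
  rw [key n]
  field_simp

section StrongLaw

variable {Ω : Type*} [MeasurableSpace Ω] {P : Measure Ω} [IsProbabilityMeasure P]

/-- A series of independent centered random variables with summable variances converges a.s. -/
lemma ae_exists_tendsto_sum_of_stronglyMeasurable {Z : ℕ → Ω → ℝ}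
    (hZ : ∀ k, StronglyMeasurable (Z k)) (hindep : iIndepFun Z P) (hL2 : ∀ k, MemLp (Z k) 2 P)
    (hmean : ∀ k, ∫ ω, Z k ω ∂P = 0) {R : ℝ}
    (hvar : ∀ n, ∑ k ∈ Finset.range n, variance (Z k) P ≤ R) :
    ∀ᵐ ω ∂P, ∃ l, Tendsto (fun n => ∑ k ∈ Finset.range n, Z k ω) atTop (𝓝 l) := by
  -- The sum runs up to and including index `n`, so that `S n` is measurable at time `n` of the
  -- natural filtration.
  set S : ℕ → Ω → ℝ := fun n => ∑ k ∈ Finset.range (n + 1), Z k with hS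
  have hint : ∀ k, Integrable (Z k) P := fun k => (hL2 k).integrable (by norm_num)
  have hSL2 : ∀ n, MemLp (S n) 2 P := fun n => memLp_finsetSum' _ fun k _ => hL2 k
  have hadp : StronglyAdapted (Filtration.natural Z hZ) S := fun n =>
    Finset.stronglyMeasurable_sum _ fun k hk =>
      (Filtration.stronglyAdapted_natural hZ k).mono
        ((Filtration.natural Z hZ).mono (Nat.lt_succ_iff.1 (Finset.mem_range.1 hk)))
  have hmart : Martingale S (Filtration.natural Z hZ) P := by
    refine martingale_of_condExp_sub_eq_zero_nat hadp
      (fun n => (hSL2 n).integrable (by norm_num)) fun n => ?_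
    have : S (n + 1) - S n = Z (n + 1) := by
      simp only [hS]
      rw [Finset.sum_range_succ _ (n + 1), add_sub_cancel_left]
    rw [this]
    filter_upwards [hindep.condExp_natural_ae_eq_of_lt hZ (Nat.lt_succ_self n)] with ω hω
    rw [hω, hmean, Pi.zero_apply]
  have hSmean : ∀ n, ∫ ω, S n ω ∂P = 0 := by
    intro n
    simp only [hS, Finset.sum_apply]
    rw [integral_finsetSum _ fun k _ => hint k]
    simp [hmean]
  -- Martingale convergence needs an `L¹` bound; the `L²` bound by `R` gives it through `|x| ≤ 1 +
  -- x²`.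
  have hbdd : ∀ n, eLpNorm (S n) 1 P ≤ ((1 + R).toNNReal : ENNReal) := by
    intro n
    have hi : Integrable (S n) P := (hSL2 n).integrable (by norm_num)
    have hsq : ∫ ω, S n ω ^ 2 ∂P ≤ R := by
      have h1 := variance_eq_sub (hSL2 n)
      rw [hSmean n] at h1
      have h2 : variance (S n) P = ∑ k ∈ Finset.range (n + 1), variance (Z k) P :=
        IndepFun.variance_sum (fun k _ => hL2 k) fun i _ j _ hij => hindep.indepFun hij
      have h3 := hvar (n + 1)
      simp only [Pi.pow_apply] at h1
      linarith
    rw [eLpNorm_one_eq_lintegral_enorm, ← ofReal_integral_norm_eq_lintegral_enorm hi]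
    refine ENNReal.ofReal_le_ofReal ?_
    calc ∫ ω, ‖S n ω‖ ∂P ≤ ∫ ω, (1 + S n ω ^ 2) ∂P := by
          refine integral_mono hi.norm ((integrable_const 1).add (hSL2 n).integrable_sq)
            fun ω => ?_
          rw [Real.norm_eq_abs]
          nlinarith [sq_abs (S n ω), sq_nonneg (|S n ω| - 1), abs_nonneg (S n ω)]
      _ ≤ 1 + R := by
          rw [integral_add (integrable_const 1) (hSL2 n).integrable_sq]
          simpa using hsq
  filter_upwards [hmart.submartingale.exists_ae_tendsto_of_bdd hbdd] with ω ⟨l, hl⟩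
  refine ⟨l, (tendsto_add_atTop_iff_nat 1).1 ?_⟩
  simpa [hS] using hl

/-- The natural filtration needs strongly measurable variables; replacing each `Z k` by such a
version changes nothing off a null set. -/
lemma ae_exists_tendsto_sum {Z : ℕ → Ω → ℝ}
    (hindep : iIndepFun Z P) (hL2 : ∀ k, MemLp (Z k) 2 P)
    (hmean : ∀ k, ∫ ω, Z k ω ∂P = 0) {R : ℝ}
    (hvar : ∀ n, ∑ k ∈ Finset.range n, variance (Z k) P ≤ R) :
    ∀ᵐ ω ∂P, ∃ l, Tendsto (fun n => ∑ k ∈ Finset.range n, Z k ω) atTop (𝓝 l) := by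
  have hae : ∀ k, Z k =ᵐ[P] (hL2 k).1.mk (Z k) := fun k => (hL2 k).1.ae_eq_mk
  have h := ae_exists_tendsto_sum_of_stronglyMeasurable (P := P)
    (Z := fun k => (hL2 k).1.mk (Z k)) (fun k => (hL2 k).1.stronglyMeasurable_mk)
    (hindep.congr hae) (fun k => (hL2 k).ae_eq (hae k))
    (fun k => by rw [← integral_congr_ae (hae k), hmean k]) (R := R)
    (fun n => by simpa only [← variance_congr (hae _)] using hvar n)
  filter_upwards [h, ae_all_iff.2 hae] with ω ⟨l, hl⟩ hω
  exact ⟨l, by simpa only [hω] using hl⟩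

lemma sum_inv_sq_le_two (n : ℕ) : ∑ k ∈ Finset.range n, (1 / ((k : ℝ) + 1)) ^ 2 ≤ 2 := by
  -- The sharper bound makes the induction telescope; at `n = 0` it reads `0 ≤ 2`, since `1 / 0 =
  -- 0`.
  have h : ∑ k ∈ Finset.range n, (1 / ((k : ℝ) + 1)) ^ (2 : ℕ) ≤ 2 - 1 / n := by
    induction n with
    | zero => norm_num
    | succ n ih =>
      rw [Finset.sum_range_succ]
      rcases Nat.eq_zero_or_pos n with rfl | hn
      · norm_num
      · have hn' : (0 : ℝ) < n := by exact_mod_cast hn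
        have : (1 / ((n : ℝ) + 1)) ^ (2 : ℕ) ≤ 1 / n - 1 / (n + 1) := by
          rw [div_sub_div _ _ (by positivity) (by positivity), div_pow,
            div_le_div_iff₀ (by positivity) (by positivity)]
          nlinarith
        push_cast
        linarith
  linarith [show (0 : ℝ) ≤ 1 / n by positivity]

/-- **Kolmogorov's strong law** for independent centered variables with bounded variances. -/
theorem ae_tendsto_average_of_variance_le {X : ℕ → Ω → ℝ}
    (hindep : iIndepFun X P) (hL2 : ∀ k, MemLp (X k) 2 P) (hmean : ∀ k, ∫ ω, X k ω ∂P = 0)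
    {V : ℝ} (hvar : ∀ k, variance (X k) P ≤ V) :
    ∀ᵐ ω ∂P, Tendsto (fun n : ℕ => (n : ℝ)⁻¹ * ∑ k ∈ Finset.range n, X k ω) atTop (𝓝 0) := by
  have hV : 0 ≤ V := (variance_nonneg _ _).trans (hvar 0)
  -- Dividing the `k`-th variable by `k + 1` makes the variances summable; Kronecker's lemma then
  -- removes the weights.
  have h := ae_exists_tendsto_sum (P := P) (Z := fun k ω => 1 / ((k : ℝ) + 1) * X k ω)
    (hindep.comp (fun k x => 1 / ((k : ℝ) + 1) * x) fun k => by fun_prop)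
    (fun k => (hL2 k).const_mul _)
    (fun k => by rw [integral_const_mul, hmean k, mul_zero]) (R := 2 * V) (fun n => by
      simp only [variance_const_mul]
      calc ∑ k ∈ Finset.range n, (1 / ((k : ℝ) + 1)) ^ 2 * variance (X k) P
          ≤ ∑ k ∈ Finset.range n, (1 / ((k : ℝ) + 1)) ^ 2 * V := by
            gcongr with k _; exact hvar k
        _ ≤ 2 * V := by
            rw [← Finset.sum_mul]
            exact mul_le_mul_of_nonneg_right (sum_inv_sq_le_two n) hV)
  filter_upwards [h] with ω ⟨l, hl⟩
  refine tendsto_average_of_tendsto_sum_div (l := l) ?_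
  simpa only [one_div_mul_eq_div] using hl

end StrongLaw

/-! ### Lyapunov's central limit theorem via characteristic functions -/

lemma norm_exp_mul_I_sub_taylor_le (x : ℝ) {δ : ℝ} (hδ : 0 < δ) (hδ1 : δ ≤ 1) :
    ‖Complex.exp (x * Complex.I) - (1 + x * Complex.I - x ^ 2 / 2)‖ ≤ 4 * |x| ^ (2 + δ) := by
  rcases le_or_gt |x| 1 with hx | hx
  -- Near zero the remainder is of order `|x|^3`, which is below `|x|^(2+δ)` because `δ ≤ 1`.
  · have h := Complex.exp_bound (x := x * Complex.I) (by simpa using hx) (n := 3) (by norm_num)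
    have e : ∑ m ∈ Finset.range 3, (x * Complex.I) ^ m / (m.factorial : ℂ) =
        1 + x * Complex.I - x ^ 2 / 2 := by
      simp [Finset.sum_range_succ, mul_pow, Nat.factorial]
      ring
    rw [e] at h
    refine h.trans ?_
    have h1 : ‖(x : ℂ) * Complex.I‖ = |x| := by simp
    have h2 : |x| ^ 3 ≤ |x| ^ (2 + δ) := by
      rcases eq_or_lt_of_le (abs_nonneg x) with h0 | h0
      · rw [← h0, Real.zero_rpow (by linarith)]; norm_num
      · rw [← Real.rpow_natCast]
        exact Real.rpow_le_rpow_of_exponent_ge h0 hx (by push_cast; linarith)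
    rw [h1]
    norm_num [Nat.factorial]
    have : 0 ≤ |x| ^ 3 := by positivity
    linarith
  -- Away from zero no cancellation is needed: `1 + (1 + |x| + |x|^2 / 2) ≤ 4 |x|^2`.
  · have h2 : |x| ^ 2 ≤ |x| ^ (2 + δ) := by
      rw [← Real.rpow_natCast]
      exact Real.rpow_le_rpow_of_exponent_le hx.le (by push_cast; linarith)
    have h3 : ‖(1 : ℂ) + x * Complex.I - x ^ 2 / 2‖ ≤ 1 + |x| + |x| ^ 2 / 2 := by
      refine (norm_sub_le _ _).trans (add_le_add ((norm_add_le _ _).trans ?_) ?_) <;> simp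
    have h4 := norm_sub_le (Complex.exp (x * Complex.I)) (1 + x * Complex.I - x ^ 2 / 2)
    rw [Complex.norm_exp_ofReal_mul_I] at h4
    nlinarith

lemma abs_exp_neg_sub_le {y : ℝ} (hy : 0 ≤ y) : |Real.exp (-y) - (1 - y)| ≤ y ^ 2 := by
  have h1 := Real.one_sub_le_exp_neg y
  rw [abs_of_nonneg (by linarith)]
  rcases le_or_gt y 1 with h | h
  · have := Real.abs_exp_sub_one_sub_id_le (x := -y) (by rwa [abs_neg, abs_of_nonneg hy])
    have := (abs_le.1 this).2
    nlinarith
  · have : Real.exp (-y) ≤ 1 := Real.exp_le_one_iff.2 (by linarith)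
    nlinarith

/-- The factors are exchanged one at a time; those left alone have norm at most one and do not
amplify the error. -/
lemma norm_prod_sub_prod_le {ι : Type*} (s : Finset ι) (f g : ι → ℂ)
    (hf : ∀ i ∈ s, ‖f i‖ ≤ 1) (hg : ∀ i ∈ s, ‖g i‖ ≤ 1) :
    ‖∏ i ∈ s, f i - ∏ i ∈ s, g i‖ ≤ ∑ i ∈ s, ‖f i - g i‖ := by
  classical
  induction s using Finset.induction_on with
  | empty => simp
  | insert a s ha ih =>
    rw [Finset.prod_insert ha, Finset.prod_insert ha, Finset.sum_insert ha]
    have hs := ih (fun i hi => hf i (Finset.mem_insert_of_mem hi))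
      fun i hi => hg i (Finset.mem_insert_of_mem hi)
    have hp : ‖∏ i ∈ s, f i‖ ≤ 1 := by
      rw [norm_prod]
      exact Finset.prod_le_one (fun _ _ => norm_nonneg _)
        fun i hi => hf i (Finset.mem_insert_of_mem hi)
    have ha' := hg a (Finset.mem_insert_self a s)
    calc ‖f a * ∏ i ∈ s, f i - g a * ∏ i ∈ s, g i‖
        = ‖(f a - g a) * ∏ i ∈ s, f i + g a * (∏ i ∈ s, f i - ∏ i ∈ s, g i)‖ := by ring_nf
      _ ≤ ‖f a - g a‖ * ‖∏ i ∈ s, f i‖ + ‖g a‖ * ‖∏ i ∈ s, f i - ∏ i ∈ s, g i‖ := by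
          simpa only [norm_mul] using norm_add_le ((f a - g a) * ∏ i ∈ s, f i)
            (g a * (∏ i ∈ s, f i - ∏ i ∈ s, g i))
      _ ≤ ‖f a - g a‖ * 1 + 1 * ‖∏ i ∈ s, f i - ∏ i ∈ s, g i‖ := by gcongr
      _ ≤ _ := by linarith

section Lyapunov

variable {Ω : Type*} [MeasurableSpace Ω] {P : Measure Ω} [IsProbabilityMeasure P]

/-- Second order expansion of a characteristic function under a bound on the absolute moment of
order `2 + δ`. -/
lemma norm_charFun_sub_le {X : Ω → ℝ} (hL2 : MemLp X 2 P) (hmean : ∫ ω, X ω ∂P = 0)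
    {δ C : ℝ} (hδ : 0 < δ) (hδ1 : δ ≤ 1) (hint : Integrable (fun ω => |X ω| ^ (2 + δ)) P)
    (hC : ∫ ω, |X ω| ^ (2 + δ) ∂P ≤ C) (t : ℝ) :
    ‖charFun (P.map X) t - ((1 - variance X P * t ^ 2 / 2 : ℝ) : ℂ)‖ ≤
      4 * C * |t| ^ (2 + δ) := by
  have hX : AEMeasurable X P := hL2.1.aemeasurable
  have hXi : Integrable X P := hL2.integrable (by norm_num)
  have hvar : variance X P = ∫ ω, X ω ^ 2 ∂P := by
    have := variance_eq_sub hL2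
    rw [hmean] at this
    simpa using this
  have hi1 : Integrable (fun ω => Complex.exp ((t * X ω : ℝ) * Complex.I)) P := by
    refine (integrable_const (1 : ℝ)).mono' (by fun_prop) (Eventually.of_forall fun ω => ?_)
    rw [Complex.norm_exp_ofReal_mul_I]
  have hreal : Integrable (fun ω => 1 - t ^ 2 / 2 * X ω ^ 2) P :=
    (integrable_const 1).sub (hL2.integrable_sq.const_mul _)
  have hlin : Integrable (fun ω => t * X ω) P := hXi.const_mul t
  have hi2 : Integrable (fun ω => (1 + (t * X ω : ℝ) * Complex.I -
      (t * X ω : ℝ) ^ 2 / 2 : ℂ)) P := by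
    refine (hreal.ofReal.add (hlin.ofReal.mul_const Complex.I)).congr
      (Eventually.of_forall fun ω => ?_)
    simp
    ring
  have hval : ∫ ω, (1 + (t * X ω : ℝ) * Complex.I - (t * X ω : ℝ) ^ 2 / 2 : ℂ) ∂P =
      ((1 - variance X P * t ^ 2 / 2 : ℝ) : ℂ) := by
    have : ∀ ω, (1 + (t * X ω : ℝ) * Complex.I - (t * X ω : ℝ) ^ 2 / 2 : ℂ) =
        ((1 - t ^ 2 / 2 * X ω ^ 2 : ℝ) : ℂ) + ((t * X ω : ℝ) : ℂ) * Complex.I := by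
      intro ω; push_cast; ring
    have e1 : Integrable (fun ω => ((1 - t ^ 2 / 2 * X ω ^ 2 : ℝ) : ℂ)) P := hreal.ofReal
    have e2 : Integrable (fun ω => ((t * X ω : ℝ) : ℂ)) P := hlin.ofReal
    simp_rw [this]
    rw [integral_add e1 (e2.mul_const Complex.I), integral_mul_const,
      integral_complex_ofReal, integral_complex_ofReal, integral_const_mul, hmean,
      integral_sub (integrable_const 1) (hL2.integrable_sq.const_mul _), integral_const_mul,
      ← hvar]
    simp
    ring
  have hcf : charFun (P.map X) t = ∫ ω, Complex.exp ((t * X ω : ℝ) * Complex.I) ∂P := by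
    rw [charFun_apply_real, integral_map hX (by fun_prop)]
    push_cast
    rfl
  rw [hcf, ← hval, ← integral_sub hi1 hi2]
  have hrp : ∀ ω, |t * X ω| ^ (2 + δ) = |t| ^ (2 + δ) * |X ω| ^ (2 + δ) := fun ω => by
    rw [abs_mul, Real.mul_rpow (abs_nonneg _) (abs_nonneg _)]
  calc _ ≤ ∫ ω, 4 * |t| ^ (2 + δ) * |X ω| ^ (2 + δ) ∂P := by
        refine norm_integral_le_of_norm_le (hint.const_mul _) (Eventually.of_forall fun ω => ?_)
        rw [mul_assoc, ← hrp]
        exact norm_exp_mul_I_sub_taylor_le _ hδ hδ1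
    _ = 4 * |t| ^ (2 + δ) * ∫ ω, |X ω| ^ (2 + δ) ∂P := integral_const_mul _ _
    _ ≤ 4 * |t| ^ (2 + δ) * C := by gcongr
    _ = _ := by ring

lemma abs_rpow_le_one_add {x p q : ℝ} (hp : 0 < p) (hpq : p ≤ q) :
    |x| ^ p ≤ 1 + |x| ^ q := by
  rcases le_or_gt |x| 1 with h | h
  · have := Real.rpow_le_one (abs_nonneg x) h hp.le
    have : 0 ≤ |x| ^ q := by positivity
    linarith
  · have := Real.rpow_le_rpow_of_exponent_le h.le hpq
    linarith

/-- The characteristic function form of Lyapunov's theorem for weighted sums with weights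
`u K k`, `k < K`. -/
theorem tendsto_prod_charFun {X : ℕ → Ω → ℝ} (hL2 : ∀ k, MemLp (X k) 2 P)
    (hmean : ∀ k, ∫ ω, X k ω ∂P = 0) {v : ℝ} (hvar : ∀ k, variance (X k) P = v)
    {δ C : ℝ} (hδ : 0 < δ)
    (hmom : ∀ k, Integrable (fun ω => |X k ω| ^ (2 + δ)) P ∧ ∫ ω, |X k ω| ^ (2 + δ) ∂P ≤ C)
    {u : ℕ → ℕ → ℝ} {b : ℕ → ℝ} (hb : Tendsto b atTop (𝓝 0))
    (hub : ∀ K, ∀ k ∈ Finset.range K, |u K k| ≤ b K) {s : ℝ}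
    (hs : Tendsto (fun K => ∑ k ∈ Finset.range K, u K k ^ 2) atTop (𝓝 s)) :
    Tendsto (fun K => ∏ k ∈ Finset.range K, charFun (P.map (X k)) (u K k)) atTop
      (𝓝 (Complex.exp ((-(v * s / 2) : ℝ) : ℂ))) := by
  have hv : 0 ≤ v := hvar 0 ▸ variance_nonneg _ _
  -- The Taylor estimate requires an exponent of at most `3`, so `δ` is lowered to `η`, at the price
  -- of the moment bound `1 + C`.
  set η := min δ 1 with hη
  have hη0 : 0 < η := lt_min hδ one_pos
  have hη1 : η ≤ 1 := min_le_right _ _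
  have hηδ : η ≤ δ := min_le_left _ _
  have hle : ∀ k ω, |X k ω| ^ (2 + η) ≤ 1 + |X k ω| ^ (2 + δ) := fun k ω =>
    abs_rpow_le_one_add (by linarith) (by linarith)
  have hdom : ∀ k, Integrable (fun ω => 1 + |X k ω| ^ (2 + δ)) P := fun k =>
    (integrable_const 1).add (hmom k).1
  have hint : ∀ k, Integrable (fun ω => |X k ω| ^ (2 + η)) P := fun k => by
    have hm : AEMeasurable (X k) P := (hL2 k).1.aemeasurable
    refine (hdom k).mono' (hm.abs.pow_const _).aestronglyMeasurable (Eventually.of_forall fun ω => ?_)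
    rw [Real.norm_of_nonneg (by positivity)]
    exact hle k ω
  have hmom' : ∀ k, ∫ ω, |X k ω| ^ (2 + η) ∂P ≤ 1 + C := fun k => by
    refine (integral_mono (hint k) (hdom k) (hle k)).trans ?_
    rw [integral_add (integrable_const 1) (hmom k).1]
    simpa using (hmom k).2
  have hC : 0 ≤ 1 + C :=
    (integral_nonneg fun ω => by positivity : 0 ≤ ∫ ω, |X 0 ω| ^ (2 + η) ∂P).trans (hmom' 0)
  -- Each factor and its Gaussian counterpart are compared with `1 - v u² / 2`; the two terms of `D`
  -- come from these two comparisons. One factor `u²` is kept aside because `∑ u²` converges, while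
  -- `|b K| → 0` forces `D → 0`.
  set D : ℕ → ℝ := fun K => 4 * (1 + C) * |b K| ^ η + v ^ 2 / 4 * |b K| ^ 2 with hD
  have hfac : ∀ K, ∀ k ∈ Finset.range K,
      ‖charFun (P.map (X k)) (u K k) - Complex.exp ((-(v * u K k ^ 2 / 2) : ℝ) : ℂ)‖ ≤
        D K * u K k ^ 2 := by
    intro K k hk
    have hu : |u K k| ≤ |b K| := (hub K k hk).trans (le_abs_self _)
    have h1 := norm_charFun_sub_le (hL2 k) (hmean k) hη0 hη1 (hint k) (hmom' k) (u K k)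
    rw [hvar k] at h1
    have h2 : ‖((1 - v * u K k ^ 2 / 2 : ℝ) : ℂ) - Complex.exp ((-(v * u K k ^ 2 / 2) : ℝ) : ℂ)‖
        ≤ (v * u K k ^ 2 / 2) ^ 2 := by
      rw [← Complex.ofReal_exp, ← Complex.ofReal_sub, Complex.norm_real, norm_sub_rev]
      exact abs_exp_neg_sub_le (by positivity)
    have h3 : |u K k| ^ (2 + η) ≤ u K k ^ 2 * |b K| ^ η := by
      rw [add_comm, Real.rpow_add_of_nonneg (abs_nonneg _) hη0.le (by norm_num), mul_comm]
      rw [Real.rpow_two, sq_abs]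
      gcongr
    have h4 : u K k ^ 2 ≤ |b K| ^ 2 := by
      rw [← sq_abs (u K k)]; gcongr
    calc _ ≤ _ := norm_sub_le_norm_sub_add_norm_sub _ ((1 - v * u K k ^ 2 / 2 : ℝ) : ℂ) _
      _ ≤ 4 * (1 + C) * (u K k ^ 2 * |b K| ^ η) + v ^ 2 / 4 * u K k ^ 2 * u K k ^ 2 := by
          refine add_le_add (h1.trans ?_) (h2.trans (le_of_eq (by ring)))
          gcongr
      _ ≤ 4 * (1 + C) * (u K k ^ 2 * |b K| ^ η) + v ^ 2 / 4 * u K k ^ 2 * |b K| ^ 2 := by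
          gcongr
      _ = _ := by simp only [hD]; ring
  have hDlim : Tendsto D atTop (𝓝 0) := by
    have hb' : Tendsto (fun K => |b K|) atTop (𝓝 0) := by simpa using hb.abs
    have h1 := (hb'.rpow_const (p := η) (Or.inr hη0.le)).const_mul (4 * (1 + C))
    have h2 := (hb'.pow 2).const_mul (v ^ 2 / 4)
    simpa [hD, Real.zero_rpow hη0.ne'] using h1.add h2
  have hexp : Tendsto (fun K => ∏ k ∈ Finset.range K,
      Complex.exp ((-(v * u K k ^ 2 / 2) : ℝ) : ℂ)) atTop
      (𝓝 (Complex.exp ((-(v * s / 2) : ℝ) : ℂ))) := by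
    have : ∀ K, ∏ k ∈ Finset.range K, Complex.exp ((-(v * u K k ^ 2 / 2) : ℝ) : ℂ) =
        Complex.exp ((-(v * (∑ k ∈ Finset.range K, u K k ^ 2) / 2) : ℝ) : ℂ) := fun K => by
      rw [← Complex.exp_sum, ← Complex.ofReal_sum, Finset.mul_sum, Finset.sum_div,
        Finset.sum_neg_distrib]
    simp_rw [this]
    refine (Complex.continuous_exp.tendsto _).comp ((Complex.continuous_ofReal.tendsto _).comp ?_)
    exact ((hs.const_mul v).div_const 2).neg
  have hdiff : Tendsto (fun K => ∏ k ∈ Finset.range K, charFun (P.map (X k)) (u K k) -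
      ∏ k ∈ Finset.range K, Complex.exp ((-(v * u K k ^ 2 / 2) : ℝ) : ℂ)) atTop (𝓝 0) := by
    refine squeeze_zero_norm (fun K => ?_) (by simpa using hDlim.mul hs)
    refine (norm_prod_sub_prod_le _ _ _ (fun k _ => ?_) fun k _ => ?_).trans ?_
    · have := Measure.isProbabilityMeasure_map (μ := P) (hL2 k).1.aemeasurable
      exact norm_charFun_le_one _
    · rw [← Complex.ofReal_exp, Complex.norm_real, Real.norm_of_nonneg (Real.exp_nonneg _)]
      exact Real.exp_le_one_iff.2 (neg_nonpos.2 (by positivity))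
    · rw [Finset.mul_sum]
      exact Finset.sum_le_sum (hfac K)
  simpa using hdiff.add hexp

end Lyapunov

/-! ### Linear algebra of least squares and Gram matrices -/

section LinearAlgebra

variable {N M : ℕ}

/-- The normal equations. -/
lemma transpose_mulVec_residual_eq_zero {K : ℕ} {A : Matrix (Fin K) (Fin M × Fin N) ℝ}
    {Y : EuclideanSpace ℝ (Fin K)} {b : Matrix (Fin N) (Fin M) ℝ} (hb : b ∈ leastSquares A Y) :
    A.transpose.mulVec (Y.ofLp - A.mulVec b.vec) = 0 := by
  set r : Fin K → ℝ := Y.ofLp - A.mulVec b.vec with hr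
  have horth : ∀ v : Fin M × Fin N → ℝ, r ⬝ᵥ A.mulVec v = 0 := by
    intro v
    have hmin : ∀ t : ℝ, r ⬝ᵥ r ≤ (r - t • A.mulVec v) ⬝ᵥ (r - t • A.mulVec v) := by
      intro t
      have h := hb (Matrix.of fun i j => b i j + t * v (j, i))
      have hv : (Matrix.of fun i j => b i j + t * v (j, i)).vec = b.vec + t • v := by
        ext ⟨j, i⟩
        simp [Matrix.vec]
      rw [hv, Matrix.mulVec_add, Matrix.mulVec_smul, EuclideanSpace.real_norm_sq_eq,
        EuclideanSpace.real_norm_sq_eq] at h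
      simpa [dotProduct, hr, sub_sub, pow_two] using h
    set p := r ⬝ᵥ A.mulVec v
    set q := A.mulVec v ⬝ᵥ A.mulVec v
    have hq : 0 ≤ q := Finset.sum_nonneg fun i _ => mul_self_nonneg _
    -- The optimal step would be `p / q`; the `+ 1` avoids dividing by zero and still forces `p =
    -- 0`.
    have h := hmin (p / (q + 1))
    have hexp : (r - (p / (q + 1)) • A.mulVec v) ⬝ᵥ (r - (p / (q + 1)) • A.mulVec v) =
        r ⬝ᵥ r - 2 * (p / (q + 1)) * p + (p / (q + 1)) ^ 2 * q := by
      simp only [sub_dotProduct, dotProduct_sub, smul_dotProduct, dotProduct_smul, smul_eq_mul,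
        dotProduct_comm (A.mulVec v) r]
      ring
    rw [hexp] at h
    have h1 : 2 * (p / (q + 1)) * p - (p / (q + 1)) ^ 2 * q =
        p ^ 2 * (q + 2) / (q + 1) ^ 2 := by
      field_simp
      ring
    have h2 : p ^ 2 * (q + 2) / (q + 1) ^ 2 ≤ 0 := by linarith
    have h3 : p ^ 2 * (q + 2) ≤ 0 := by
      by_contra hcon
      exact absurd h2 (not_le.2 (div_pos (not_le.1 hcon) (by positivity)))
    have h4 : p ^ 2 ≤ 0 := by nlinarith [sq_nonneg p]
    exact pow_eq_zero_iff two_ne_zero |>.1 (le_antisymm h4 (sq_nonneg p))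
  refine dotProduct_eq_zero _ fun v => ?_
  rw [Matrix.mulVec_transpose, ← Matrix.dotProduct_mulVec]
  exact horth v

lemma frobInner_eq_vec_dotProduct (c p : Matrix (Fin N) (Fin M) ℝ) :
    frobInner c p = p.vec ⬝ᵥ c.vec := by
  simp only [frobInner, dotProduct, Matrix.vec, Fintype.sum_prod_type]
  rw [Finset.sum_comm]
  simp only [mul_comm]

/-- The normalized Gram matrix `K⁻¹ Pᵀ P` of the first `K` plans. -/
noncomputable def gram (π : ℕ → Matrix (Fin N) (Fin M) ℝ) (K : ℕ) :
    Matrix (Fin M × Fin N) (Fin M × Fin N) ℝ :=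
  (1 / (K : ℝ)) • ((designMatrix π K).transpose * designMatrix π K)

/-- This turns the sum of squared weights in Lyapunov's theorem into a quadratic form, whose limit
follows from that of the Gram matrices. -/
lemma dotProduct_gram_mulVec (π : ℕ → Matrix (Fin N) (Fin M) ℝ) (K : ℕ)
    (w : Fin M × Fin N → ℝ) :
    w ⬝ᵥ (gram π K).mulVec w =
      ∑ k ∈ Finset.range K, ((√(K : ℝ))⁻¹ * (w ⬝ᵥ (π k).vec)) ^ 2 := by
  rw [gram, Matrix.smul_mulVec, dotProduct_smul, ← Matrix.mulVec_mulVec, Matrix.dotProduct_mulVec,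
    Matrix.vecMul_transpose, Finset.sum_range]
  simp only [mul_pow, inv_pow, Real.sq_sqrt (Nat.cast_nonneg K : (0 : ℝ) ≤ K), ← Finset.mul_sum,
    smul_eq_mul, one_div]
  congr 1
  refine Finset.sum_congr rfl fun k _ => ?_
  have : (designMatrix π K).mulVec w k = w ⬝ᵥ (π k).vec := dotProduct_comm _ _
  rw [this, pow_two]

/-- The normal equations in terms of the noise. -/
lemma gram_mulVec_sub_eq {Ω : Type*} {π : ℕ → Matrix (Fin N) (Fin M) ℝ} {α : ℕ → ℝ}
    {c b : Matrix (Fin N) (Fin M) ℝ} (hα : ∀ k, α k = frobInner c (π k)) {ε : ℕ → Ω → ℝ} {K : ℕ}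
    {ω : Ω} (hb : b ∈ leastSquares (designMatrix π K) (observations α ε K ω)) :
    (gram π K).mulVec (b.vec - c.vec) =
      (K : ℝ)⁻¹ • ∑ k ∈ Finset.range K, ε k ω • (π k).vec := by
  set A := designMatrix π K with hA
  have hY : (observations α ε K ω).ofLp = A.mulVec c.vec + fun k : Fin K => ε k ω := by
    ext k
    have : A.mulVec c.vec k = α k := by
      rw [hα, frobInner_eq_vec_dotProduct]
      rfl
    simp [observations, this]
  have h := transpose_mulVec_residual_eq_zero hb
  rw [hY, add_sub_right_comm, ← Matrix.mulVec_sub, Matrix.mulVec_add, Matrix.mulVec_mulVec,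
    ← neg_sub b.vec, Matrix.mulVec_neg, neg_add_eq_zero] at h
  rw [gram, Matrix.smul_mulVec, h, one_div]
  congr 1
  ext i
  simp [Matrix.mulVec, dotProduct, Finset.sum_range, hA, designMatrix, mul_comm]

/-- An entry is at most its row sum, hence at most the total mass. This uniform bound on the design
controls the variances in the strong law and makes the weights in the central limit theorem
uniformly small. -/
lemma vec_mem_Icc_of_mem_transportPlans {m : Fin N → ℝ} {n : Fin M → ℝ}
    (hm : m ∈ stdSimplex ℝ (Fin N)) {p : Matrix (Fin N) (Fin M) ℝ}
    (hp : p ∈ transportPlans m n) (i : Fin M × Fin N) : p.vec i ∈ Set.Icc (0 : ℝ) 1 := by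
  obtain ⟨j, i⟩ := i
  refine ⟨hp.1 i j, ?_⟩
  calc p i j ≤ ∑ j, p i j := Finset.single_le_sum (fun j _ => hp.1 i j) (Finset.mem_univ j)
    _ = m i := hp.2.1 i
    _ ≤ ∑ i, m i := Finset.single_le_sum (fun i _ => hm.1 i) (Finset.mem_univ i)
    _ = 1 := hm.2

/-- Both parts follow from continuity of the determinant and `det Q ≠ 0`. The second is needed to
cancel, as `⁻¹` is a true inverse only for invertible determinant. -/
lemma tendsto_matrix_inv {ι : Type*} [Fintype ι] [DecidableEq ι] {G : ℕ → Matrix ι ι ℝ}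
    {Q : Matrix ι ι ℝ} (hQ : Q.PosDef) (hG : Tendsto G atTop (𝓝 Q)) :
    Tendsto (fun K => (G K)⁻¹) atTop (𝓝 Q⁻¹) ∧ ∀ᶠ K in atTop, IsUnit (G K).det := by
  have hdet : Tendsto (fun K => (G K).det) atTop (𝓝 Q.det) :=
    (continuous_id.matrix_det.tendsto Q).comp hG
  refine ⟨(continuousAt_matrix_inv Q ?_).tendsto.comp hG, ?_⟩
  · rw [Ring.inverse_eq_inv']
    exact continuousAt_inv₀ hQ.det_pos.ne'
  · filter_upwards [hdet.eventually_ne hQ.det_pos.ne'] with K hK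
    exact isUnit_iff_ne_zero.2 hK

lemma tendsto_mulVec {ι : Type*} [Fintype ι] {G : ℕ → Matrix ι ι ℝ} {Q : Matrix ι ι ℝ}
    {x : ℕ → ι → ℝ} {y : ι → ℝ} (hG : Tendsto G atTop (𝓝 Q)) (hx : Tendsto x atTop (𝓝 y)) :
    Tendsto (fun K => (G K).mulVec (x K)) atTop (𝓝 (Q.mulVec y)) :=
  ((by fun_prop : Continuous fun p : Matrix ι ι ℝ × (ι → ℝ) => p.1.mulVec p.2).tendsto
    (Q, y)).comp (hG.prodMk_nhds hx)

lemma tendsto_dotProduct {ι : Type*} [Fintype ι] {x x' : ℕ → ι → ℝ} {y y' : ι → ℝ}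
    (hx : Tendsto x atTop (𝓝 y)) (hx' : Tendsto x' atTop (𝓝 y')) :
    Tendsto (fun K => x K ⬝ᵥ x' K) atTop (𝓝 (y ⬝ᵥ y')) :=
  ((by fun_prop : Continuous fun p : (ι → ℝ) × (ι → ℝ) => p.1 ⬝ᵥ p.2).tendsto
    (y, y')).comp (hx.prodMk_nhds hx')

end LinearAlgebra

/-! ### Consistency and asymptotic normality of the estimator -/

section Estimator

/-- The characteristic function of a random vector whose inner product with `t` is a weighted sum
of independent variables. -/
lemma charFun_map_eq_prod {Ω : Type*} [MeasurableSpace Ω] {P : Measure Ω} {ε : ℕ → Ω → ℝ}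
    {ι : Type*} [Fintype ι] {W : Ω → EuclideanSpace ℝ ι}
    (hW : AEMeasurable W P) (hindep : iIndepFun ε P) (hε : ∀ k, AEMeasurable (ε k) P)
    {t : EuclideanSpace ℝ ι} {K : ℕ} {u : ℕ → ℝ}
    (h : ∀ᵐ ω ∂P, inner ℝ (W ω) t = ∑ k ∈ Finset.range K, u k * ε k ω) :
    charFun (P.map W) t = ∏ k ∈ Finset.range K, charFun (P.map (ε k)) (u k) := by
  have hi : iIndepFun (fun k ω => u k * ε k ω) P :=
    hindep.comp (fun k x => u k * x) fun k => by fun_prop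
  have hm : ∀ k, AEMeasurable (fun ω => u k * ε k ω) P := fun k => (hε k).const_mul _
  -- At argument `1` the characteristic function of `u k * ε k` is that of `ε k` at `u k`.
  have h1 := congrFun ((hi.restrict (Finset.range K)).charFun_map_fun_finsetSum_eq_prod
    (fun k _ => hm k)) 1
  rw [Finset.prod_apply] at h1
  simp only [charFun_map_mul_comp (hε _), mul_one] at h1
  rw [← h1, charFun_apply, charFun_apply_real, integral_map hW (by fun_prop),
    integral_map (Finset.aemeasurable_fun_sum _ fun k _ => hm k) (by fun_prop)]
  refine integral_congr_ae ?_
  filter_upwards [h] with ω hω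
  rw [hω, Complex.ofReal_one, one_mul]

variable {Ω : Type*} [MeasurableSpace Ω] {P : Measure Ω} [IsProbabilityMeasure P] {N M : ℕ}
  {π : ℕ → Matrix (Fin N) (Fin M) ℝ} {c : Matrix (Fin N) (Fin M) ℝ} {ε : ℕ → Ω → ℝ}
  {Q : Matrix (Fin M × Fin N) (Fin M × Fin N) ℝ} {cHat : ℕ → Ω → Matrix (Fin N) (Fin M) ℝ}

/-- Strong consistency of solutions of the normal equations. -/
theorem ae_tendsto_estimator (hbd : ∀ k i, (π k).vec i ∈ Set.Icc (0 : ℝ) 1)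
    (hindep : iIndepFun ε P) (hL2 : ∀ k, MemLp (ε k) 2 P) (hmean : ∀ k, ∫ ω, ε k ω ∂P = 0)
    {v : ℝ} (hvar : ∀ k, variance (ε k) P = v) (hQ : Q.PosDef)
    (hlim : Tendsto (gram π) atTop (𝓝 Q))
    (hnormal : ∀ K, ∀ᵐ ω ∂P, (gram π K).mulVec ((cHat K ω).vec - c.vec) =
      (K : ℝ)⁻¹ • ∑ k ∈ Finset.range K, ε k ω • (π k).vec) :
    ∀ᵐ ω ∂P, Tendsto (fun K => vecE (cHat K ω)) atTop (𝓝 (vecE c)) := by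
  have hv : 0 ≤ v := hvar 0 ▸ variance_nonneg _ _
  have hslln : ∀ i, ∀ᵐ ω ∂P, Tendsto
      (fun K : ℕ => (K : ℝ)⁻¹ * ∑ k ∈ Finset.range K, (π k).vec i * ε k ω) atTop (𝓝 0) := by
    intro i
    refine ae_tendsto_average_of_variance_le
      (hindep.comp (fun k x => (π k).vec i * x) fun k => by fun_prop)
      (fun k => (hL2 k).const_mul _) (fun k => ?_) (V := v) fun k => ?_
    · exact (integral_const_mul _ _).trans (by rw [hmean k, mul_zero])
    · refine (variance_const_mul _ _ _).trans_le ?_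
      rw [hvar k]
      exact mul_le_of_le_one_left hv (pow_le_one₀ (hbd k i).1 (hbd k i).2)
  obtain ⟨hinv, hunit⟩ := tendsto_matrix_inv hQ hlim
  filter_upwards [ae_all_iff.2 hslln, ae_all_iff.2 hnormal] with ω hω hn
  have hS : Tendsto (fun K : ℕ => (K : ℝ)⁻¹ • ∑ k ∈ Finset.range K, ε k ω • (π k).vec) atTop
      (𝓝 0) := by
    refine tendsto_pi_nhds.2 fun i => (hω i).congr fun K => ?_
    simp [Finset.sum_apply, mul_comm]
  have hdiff : Tendsto (fun K => (cHat K ω).vec - c.vec) atTop (𝓝 0) := by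
    have := tendsto_mulVec hinv hS
    rw [Matrix.mulVec_zero] at this
    refine this.congr' ?_
    filter_upwards [hunit] with K hK
    rw [← hn K, Matrix.mulVec_mulVec, Matrix.nonsing_inv_mul _ hK, Matrix.one_mulVec]
  have hvec : Tendsto (fun K => (cHat K ω).vec) atTop (𝓝 c.vec) := by
    simpa using hdiff.add_const c.vec
  exact ((PiLp.continuous_toLp 2 _).tendsto _).comp hvec

/-- Asymptotic normality of solutions of the normal equations. -/
theorem tendstoInDistribution_estimator (hbd : ∀ k i, (π k).vec i ∈ Set.Icc (0 : ℝ) 1)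
    (hindep : iIndepFun ε P) (hL2 : ∀ k, MemLp (ε k) 2 P) (hmean : ∀ k, ∫ ω, ε k ω ∂P = 0)
    {v : ℝ} (hvar : ∀ k, variance (ε k) P = v) (hQ : Q.PosDef)
    (hlim : Tendsto (gram π) atTop (𝓝 Q))
    (hmeas : ∀ K, AEMeasurable (fun ω => vecE (cHat K ω)) P)
    (hnormal : ∀ K, ∀ᵐ ω ∂P, (gram π K).mulVec ((cHat K ω).vec - c.vec) =
      (K : ℝ)⁻¹ • ∑ k ∈ Finset.range K, ε k ω • (π k).vec)
    {δ C : ℝ} (hδ : 0 < δ)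
    (hmom : ∀ k, Integrable (fun ω => |ε k ω| ^ (2 + δ)) P ∧ ∫ ω, |ε k ω| ^ (2 + δ) ∂P ≤ C) :
    TendstoInDistribution (fun (K : ℕ) ω => √(K : ℝ) • (vecE (cHat K ω) - vecE c)) atTop
      (id : EuclideanSpace ℝ (Fin M × Fin N) → EuclideanSpace ℝ (Fin M × Fin N))
      (fun _ => P) (multivariateGaussian 0 (v • Q⁻¹)) where
  forall_aemeasurable K := by
    have := hmeas K
    fun_prop
  tendsto := by
    have hv : 0 ≤ v := hvar 0 ▸ variance_nonneg _ _
    have hWm : ∀ K : ℕ, AEMeasurable (fun ω => √(K : ℝ) • (vecE (cHat K ω) - vecE c)) P :=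
      fun K => by
        have := hmeas K
        fun_prop
    refine ProbabilityMeasure.tendsto_iff_tendsto_charFun.2 fun t => ?_
    obtain ⟨hinv, hunit⟩ := tendsto_matrix_inv hQ hlim
    -- Transposing moves the inverse Gram matrix onto `t`, so that pairing the error with `t` leaves
    -- scalar weights `w K ⬝ᵥ (π k).vec`.
    set w : ℕ → Fin M × Fin N → ℝ := fun K => (gram π K)⁻¹.transpose.mulVec t.ofLp with hw
    set w' : Fin M × Fin N → ℝ := Q⁻¹.transpose.mulVec t.ofLp with hw'
    have hwlim : Tendsto w atTop (𝓝 w') :=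
      tendsto_mulVec ((continuous_id.matrix_transpose.tendsto _).comp hinv) tendsto_const_nhds
    -- The sum is the quadratic form of the Gram matrix at `w K`; in the limit `Q⁻¹ Q Q⁻¹` collapses
    -- to `Q⁻¹`.
    have hsum : Tendsto (fun K : ℕ => ∑ k ∈ Finset.range K,
        ((√(K : ℝ))⁻¹ * (w K ⬝ᵥ (π k).vec)) ^ 2) atTop (𝓝 (t.ofLp ⬝ᵥ Q⁻¹.mulVec t.ofLp)) := by
      have h := tendsto_dotProduct hwlim (tendsto_mulVec hlim hwlim)
      simp only [dotProduct_gram_mulVec] at h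
      have hval : w' ⬝ᵥ Q.mulVec w' = t.ofLp ⬝ᵥ Q⁻¹.mulVec t.ofLp := by
        have hsymm : Q⁻¹.transpose = Q⁻¹ := by
          simpa using hQ.inv.isHermitian.eq
        rw [hw', hsymm, Matrix.mulVec_mulVec,
          Matrix.mul_nonsing_inv _ (isUnit_iff_ne_zero.2 hQ.det_pos.ne'), Matrix.one_mulVec,
          dotProduct_comm]
      rwa [hval] at h
    have hb : Tendsto (fun K : ℕ => (√(K : ℝ))⁻¹ * ∑ i, |w K i|) atTop (𝓝 0) := by
      have h1 : Tendsto (fun K : ℕ => (√(K : ℝ))⁻¹) atTop (𝓝 0) :=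
        tendsto_inv_atTop_zero.comp (Real.tendsto_sqrt_atTop.comp tendsto_natCast_atTop_atTop)
      have h2 : Tendsto (fun K => ∑ i, |w K i|) atTop (𝓝 (∑ i, |w' i|)) :=
        tendsto_finsetSum _ fun i _ => ((tendsto_pi_nhds.1 hwlim) i).abs
      simpa using h1.mul h2
    have hub : ∀ K : ℕ, ∀ k ∈ Finset.range K,
        |(√(K : ℝ))⁻¹ * (w K ⬝ᵥ (π k).vec)| ≤ (√(K : ℝ))⁻¹ * ∑ i, |w K i| := by
      intro K k _
      rw [abs_mul, abs_of_nonneg (by positivity : 0 ≤ (√(K : ℝ))⁻¹)]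
      gcongr
      refine (Finset.abs_sum_le_sum_abs _ _).trans (Finset.sum_le_sum fun i _ => ?_)
      rw [abs_mul, abs_of_nonneg (hbd k i).1]
      exact mul_le_of_le_one_right (abs_nonneg _) (hbd k i).2
    have hclt := tendsto_prod_charFun hL2 hmean hvar hδ hmom hb hub hsum
    have hpsd : (v • Q⁻¹).PosSemidef := hQ.inv.posSemidef.smul hv
    simp only [ProbabilityMeasure.coe_mk, Measure.map_id, charFun_multivariateGaussian hpsd]
    have hgoal : Complex.exp ((-(v * (t.ofLp ⬝ᵥ Q⁻¹.mulVec t.ofLp) / 2) : ℝ) : ℂ) =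
        Complex.exp ((inner ℝ t (0 : EuclideanSpace ℝ (Fin M × Fin N)) : ℝ) * Complex.I -
          ((t.ofLp ⬝ᵥ (v • Q⁻¹).mulVec t.ofLp : ℝ) : ℂ) / 2) := by
      rw [Matrix.smul_mulVec, dotProduct_smul, inner_zero_right]
      push_cast
      simp
    rw [hgoal] at hclt
    refine hclt.congr' ?_
    -- The estimation error is an explicit weighted noise sum only once the Gram matrix is
    -- invertible, hence the eventual equality.
    filter_upwards [hunit] with K hK
    refine (charFun_map_eq_prod (hWm K) hindep (fun k => (hL2 k).1.aemeasurable) ?_).symm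
    filter_upwards [hnormal K] with ω hω
    have hdiff : (cHat K ω).vec - c.vec = (gram π K)⁻¹.mulVec
        ((K : ℝ)⁻¹ • ∑ k ∈ Finset.range K, ε k ω • (π k).vec) := by
      rw [← hω, Matrix.mulVec_mulVec, Matrix.nonsing_inv_mul _ hK, Matrix.one_mulVec]
    have hinner : inner ℝ (√(K : ℝ) • (vecE (cHat K ω) - vecE c)) t =
        √(K : ℝ) * (t.ofLp ⬝ᵥ ((cHat K ω).vec - c.vec)) := by
      rw [EuclideanSpace.inner_eq_star_dotProduct, star_trivial]
      exact dotProduct_smul _ _ _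
    rw [hinner, hdiff, Matrix.dotProduct_mulVec, ← Matrix.mulVec_transpose, dotProduct_smul,
      dotProduct_sum, smul_eq_mul, ← mul_assoc, ← div_eq_mul_inv, Real.sqrt_div_self,
      Finset.mul_sum]
    refine Finset.sum_congr rfl fun k _ => ?_
    rw [dotProduct_smul, smul_eq_mul]
    ring

end Estimator

end InverseOT

theorem mainTheorem9 {Ω : Type*} [MeasurableSpace Ω] (Pr : Measure Ω) [IsProbabilityMeasure Pr]
    {N M : ℕ}
    -- pairs of marginals, observed transport plans and total costs
    (μ : ℕ → Fin N → ℝ) (ν : ℕ → Fin M → ℝ)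
    (hμ : ∀ k, μ k ∈ stdSimplex ℝ (Fin N)) (hν : ∀ k, ν k ∈ stdSimplex ℝ (Fin M))
    (π : ℕ → Matrix (Fin N) (Fin M) ℝ)
    (hπ : ∀ k, π k ∈ InverseOT.transportPlans (μ k) (ν k))
    (α : ℕ → ℝ)
    -- the underlying cost matrix
    (c : Matrix (Fin N) (Fin M) ℝ)
    (hc : ∀ k, α k = InverseOT.otCost c (μ k) (ν k) ∧ α k = InverseOT.frobInner c (π k))
    -- independent centered errors with common variance
    (σ : ℝ) (hσ : 0 < σ)
    (ε : ℕ → Ω → ℝ)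
    (hε_indep : iIndepFun ε Pr)
    (hε_memLp : ∀ k, MemLp (ε k) 2 Pr)
    (hε_mean : ∀ k, ∫ ω, ε k ω ∂Pr = 0)
    (hε_var : ∀ k, variance (ε k) Pr = σ ^ 2)
    -- the limiting Gram matrix
    (Q : Matrix (Fin M × Fin N) (Fin M × Fin N) ℝ) (hQ : Q.PosDef)
    (hlim : Tendsto
      (fun K : ℕ => (1 / (K : ℝ)) •
        ((InverseOT.designMatrix π K).transpose * InverseOT.designMatrix π K))
      atTop (𝓝 Q))
    -- the least squares estimator
    (cHat : ℕ → Ω → Matrix (Fin N) (Fin M) ℝ)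
    (hcHat_meas : ∀ K, AEMeasurable (fun ω => InverseOT.vecE (cHat K ω)) Pr)
    (hcHat : ∀ K, ∀ᵐ ω ∂Pr, cHat K ω ∈
      InverseOT.leastSquares (InverseOT.designMatrix π K) (InverseOT.observations α ε K ω)) :
    (∀ᵐ ω ∂Pr, Tendsto (fun K => InverseOT.vecE (cHat K ω)) atTop (𝓝 (InverseOT.vecE c))) ∧
    ((∃ δ : ℝ, 0 < δ ∧ ∃ C : ℝ, ∀ k,
        Integrable (fun ω => |ε k ω| ^ (2 + δ)) Pr ∧ ∫ ω, |ε k ω| ^ (2 + δ) ∂Pr ≤ C) →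
      TendstoInDistribution
        (fun (K : ℕ) ω => Real.sqrt (K : ℝ) • (InverseOT.vecE (cHat K ω) - InverseOT.vecE c))
        atTop (id : EuclideanSpace ℝ (Fin M × Fin N) → EuclideanSpace ℝ (Fin M × Fin N))
        (fun _ => Pr) (multivariateGaussian 0 (σ ^ 2 • Q⁻¹))) := by

  have hnormal := fun K => (hcHat K).mono fun ω hω =>
    InverseOT.gram_mulVec_sub_eq (fun k => (hc k).2) hω
  have hbd := fun k => InverseOT.vec_mem_Icc_of_mem_transportPlans (hμ k) (hπ k)
  refine ⟨InverseOT.ae_tendsto_estimator hbd hε_indep hε_memLp hε_mean hε_var hQ hlim hnormal, ?_⟩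
  rintro ⟨δ, hδ, C, hmom⟩
  exact InverseOT.tendstoInDistribution_estimator hbd hε_indep hε_memLp hε_mean hε_var hQ hlim
    hcHat_meas hnormal hδ hmom
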